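/- Let $q$ be a prime power, let $t\ge 3$ and $t'\ge 1$ be integers, put $n=tt'$, and consider the finite fields $\mathbb F_q\subseteq\mathbb F_{q^t}\subseteq\mathbb F_{q^n}$. Consider the polynomials of the form $$f(x)=\sum_{i=0}^{t'-1}a_i\,x^{q^{it+s}}\in\mathbb F_{q^n}[x],\qquad s\in\mathbb N,\ \gcd(s,t)=1,\ a_0,\dots,a_{t'-1}\in\mathbb F_{q^n},\tag{1}$$ where $s$ may vary. Such an $f$ is called R-$q^t$-partially scattered if for all $y,z\in\mathbb F_{q^n}^*$ $$\frac{f(y)}{y}=\frac{f(z)}{z}\ \text{ and }\ \frac yz\in\mathbb F_{q^t}\ \Longrightarrow\ \frac yz\in\mathbb F_q .$$ Put $U_f=\{(x,f(x)) : x\in\mathbb F_{q^n}\}$. Two polynomials $f,g$ are called weakly equivalent if there is $\varphi\in\Gamma\mathrm L(2t',q^t)$, i.e. an invertible $\mathbb F_{q^t}$-semilinear map of the $2t'$-dimensional $\mathbb F_{q^t}$-vector space $\mathbb F_{q^n}\times\mathbb F_{q^n}$ onto itself (with respect to some automorphism of $\mathbb F_{q^t}$), such that $\varphi(U_f)=U_g$.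 This is an equivalence relation. Then the R-$q^t$-partially scattered polynomials of the form (1) fall into exactly $\varphi(t)/2$ weak equivalence classes, where in this count $\varphi$ denotes Euler's totient function. -/

import Mathlib

open Polynomial

/-- `f` is of the form `∑_{i < t'} a_i x^{q^{it+s}}` for some coefficients `a_i ∈ Fn` and some
natural number `s` coprime to `t`. -/
def IsOfForm {Fn : Type*} [Field Fn] (q t t' : ℕ) (f : Fn[X]) : Prop :=
  ∃ s : ℕ, Nat.Coprime s t ∧
    ∃ a : Fin t' → Fn, f = ∑ i : Fin t', C (a i) * X ^ (q ^ ((i : ℕ) * t + s))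

/-- `f` is R-`q^t`-partially scattered (of index `0`), where `Fq ⊆ Ft ⊆ Fn` are the fields with
`q`, `q^t` and `q^n` elements. -/
def IsRPartiallyScattered (Fq Ft : Type*) {Fn : Type*} [Field Fq] [Field Ft] [Field Fn]
    [Algebra Fq Fn] [Algebra Ft Fn] (f : Fn[X]) : Prop :=
  ∀ y z : Fn, y ≠ 0 → z ≠ 0 → f.eval y / y = f.eval z / z →
    y / z ∈ Set.range (algebraMap Ft Fn) → y / z ∈ Set.range (algebraMap Fq Fn)

/-- `U_f = {(x, f(x)) : x ∈ Fn}`. -/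
def graphSet {Fn : Type*} [Field Fn] (f : Fn[X]) : Set (Fn × Fn) :=
  Set.range fun x : Fn => (x, f.eval x)

/-- Weak equivalence of `f` and `g`: some invertible `Ft`-semilinear map `φ` of the `Ft`-vector space
`Fn × Fn`, with companion automorphism `σ` (that is, an element of `ΓL(2t', q^t)`), maps `U_f` onto
`U_g`. -/
def WeaklyEquivalent (Ft : Type*) {Fn : Type*} [Field Ft] [Field Fn] [Algebra Ft Fn]
    (f g : Fn[X]) : Prop :=
  ∃ (σ : Ft ≃+* Ft) (φ : (Fn × Fn) ≃+ (Fn × Fn)),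
    (∀ (c : Ft) (v : Fn × Fn), φ (c • v) = σ c • φ v) ∧ φ '' graphSet f = graphSet g

theorem WeaklyEquivalent.refl (Ft : Type*) {Fn : Type*} [Field Ft] [Field Fn] [Algebra Ft Fn]
    (f : Fn[X]) : WeaklyEquivalent Ft f f :=
  ⟨RingEquiv.refl Ft, AddEquiv.refl (Fn × Fn), fun _ _ => rfl, Set.image_id _⟩

theorem WeaklyEquivalent.symm {Ft Fn : Type*} [Field Ft] [Field Fn] [Algebra Ft Fn]
    {f g : Fn[X]} (h : WeaklyEquivalent Ft f g) : WeaklyEquivalent Ft g f := by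
  obtain ⟨σ, φ, hφ, h⟩ := h
  refine ⟨σ.symm, φ.symm, fun c v => ?_, ?_⟩
  · apply φ.injective
    rw [hφ]
    simp
  · rw [← h, Set.image_image]
    simp

theorem WeaklyEquivalent.trans {Ft Fn : Type*} [Field Ft] [Field Fn] [Algebra Ft Fn]
    {f g h : Fn[X]} (h₁ : WeaklyEquivalent Ft f g) (h₂ : WeaklyEquivalent Ft g h) :
    WeaklyEquivalent Ft f h := by
  obtain ⟨σ, φ, hφ, h₁⟩ := h₁
  obtain ⟨τ, ψ, hψ, h₂⟩ := h₂
  refine ⟨σ.trans τ, φ.trans ψ, fun c v => ?_, ?_⟩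
  · simp [hφ, hψ]
  · rw [← h₂, ← h₁, Set.image_image]
    rfl

/-- Weak equivalence, restricted to the R-`q^t`-partially scattered polynomials of the form
`∑_{i < t'} a_i x^{q^{it+s}}`, `gcd(s, t) = 1`. -/
def weakEquivalenceSetoid (Fq Ft Fn : Type*) [Field Fq] [Field Ft] [Field Fn]
    [Algebra Fq Fn] [Algebra Ft Fn] (q t t' : ℕ) :
    Setoid {f : Fn[X] // IsOfForm q t t' f ∧ IsRPartiallyScattered Fq Ft f} where
  r f g := WeaklyEquivalent Ft f.1 g.1
  iseqv := ⟨fun f => WeaklyEquivalent.refl Ft f.1, WeaklyEquivalent.symm,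
    WeaklyEquivalent.trans⟩

/-! On `Ft` one has `c ^ (q ^ t) = c`, so every `f` of the given form is `Ft`-semilinear with
companion `c ↦ c ^ (q ^ s)`. As `s` is prime to `t`, this companion fixes only `Fq`, and being
partially scattered reduces to bijectivity (`isRPartiallyScattered_iff_injective`). For bijective
`f` only the companion matters, and swapping coordinates inverts it, so `s` and `-s` mod `t` give
the same class. Dedekind independence shows that nothing else is identified
(`modEq_or_of_weaklyEquivalent`). The classes are thus the orbits of negation on `(ZMod t)ˣ`, all of
size two because `3 ≤ t`. -/

section FrobeniusPowers

variable {K L : Type*} [Field K] [Field L] [Algebra K L] [Finite L]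

theorem frobenius_pow_apply [Fintype K] (k : ℕ) (x : L) :
    (FiniteField.frobeniusAlgEquivOfAlgebraic K L ^ k) x = x ^ (Nat.card K ^ k) := by
  rw [AlgEquiv.coe_pow, FiniteField.coe_frobeniusAlgEquivOfAlgebraic_iterate,
    Fintype.card_eq_nat_card]

variable (K) in
theorem finite_of_algebra_finite (L : Type*) [Field L] [Algebra K L] [Finite L] : Finite K :=
  Finite.of_injective _ (algebraMap K L).injective

variable (K) in
theorem add_pow_card_pow (k : ℕ) (x y : L) :
    (x + y) ^ (Nat.card K ^ k) = x ^ (Nat.card K ^ k) + y ^ (Nat.card K ^ k) := by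
  have := finite_of_algebra_finite K L
  have := Fintype.ofFinite K
  simp only [← frobenius_pow_apply, map_add]

variable (K L) in
/-- Two powers of the `K`-Frobenius agree on `L` iff the exponents agree modulo `[L : K]`. -/
theorem forall_pow_card_pow_eq_iff (a b : ℕ) :
    (∀ x : L, x ^ (Nat.card K ^ a) = x ^ (Nat.card K ^ b)) ↔ a ≡ b [MOD Module.finrank K L] := by
  have := finite_of_algebra_finite K L
  have := Fintype.ofFinite K
  rw [← FiniteField.orderOf_frobeniusAlgEquivOfAlgebraic K L, ← pow_eq_pow_iff_modEq,
    DFunLike.ext_iff]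
  simp only [frobenius_pow_apply]

/-- The fixed field of a power of the Frobenius that generates the Galois group is the base. -/
theorem mem_range_algebraMap_of_pow_card_pow_eq {s : ℕ} (hs : s.Coprime (Module.finrank K L))
    {x : L} (hx : x ^ (Nat.card K ^ s) = x) : x ∈ Set.range (algebraMap K L) := by
  have := finite_of_algebra_finite K L
  have := Fintype.ofFinite K
  rw [IsGalois.mem_range_algebraMap_iff_fixed]
  intro g
  obtain ⟨n, rfl⟩ := (FiniteField.bijective_frobeniusAlgEquivOfAlgebraic_pow K L).2 g
  -- The `s`-th power of the Frobenius still generates the Galois group, so its fixed points are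
  -- fixed by everything.
  obtain ⟨m, hm⟩ := exists_pow_eq_self_of_coprime
    (n := s) (x := FiniteField.frobeniusAlgEquivOfAlgebraic K L)
    (by rwa [FiniteField.orderOf_frobeniusAlgEquivOfAlgebraic])
  have h : FiniteField.frobeniusAlgEquivOfAlgebraic K L ^ s ∈ MulAction.stabilizer Gal(L/K) x := by
    rw [MulAction.mem_stabilizer_iff, AlgEquiv.smul_def, frobenius_pow_apply, hx]
  have h' := pow_mem (pow_mem h m) (n : ℕ)
  rwa [hm] at h'

/-- Dedekind independence for powers of the Frobenius, with coefficients in an extension field. -/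
theorem eq_zero_of_sum_pow_card_pow_smul {M : Type*} [Field M] [Algebra L M] {ι : Type*}
    [Fintype ι] {k : ι → ℕ} (hk : ∀ i j, k i ≡ k j [MOD Module.finrank K L] → i = j) {a : ι → M}
    (h : ∀ x : L, ∑ i, x ^ (Nat.card K ^ k i) • a i = 0) (i : ι) : a i = 0 := by
  let χ : ι → L →* M := fun i =>
    (algebraMap L M : L →* M).comp (powMonoidHom (Nat.card K ^ k i))
  have hχ : Function.Injective χ := fun i j hij => hk i j <|
    (forall_pow_card_pow_eq_iff K L _ _).1 fun x => (algebraMap L M).injective <|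
      DFunLike.congr_fun hij x
  have hli := (linearIndependent_monoidHom L M).comp χ hχ
  refine Fintype.linearIndependent_iff.1 hli a ?_ i
  ext x
  simpa [χ, Algebra.smul_def, mul_comm] using h x

end FrobeniusPowers

/-- An additive map that is semilinear over `K` with respect to `c ↦ c ^ m`. -/
structure IsPowSemilinear (K : Type*) {L : Type*} [Field K] [Field L] [Algebra K L] (m : ℕ)
    (h : L → L) : Prop where
  map_add : ∀ x y, h (x + y) = h x + h y
  map_smul : ∀ (c : K) (x : L), h (c • x) = c ^ m • h x

namespace IsPowSemilinear

variable {K L : Type*} [Field K] [Field L] [Algebra K L] {m : ℕ} {h : L → L}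

theorem injective_iff (hh : IsPowSemilinear K m h) :
    Function.Injective h ↔ ∀ x, h x = 0 → x = 0 :=
  injective_iff_map_eq_zero (AddMonoidHom.mk' h hh.map_add)

/-- A bijective semilinear map as an additive equivalence. -/
noncomputable def addEquiv (hh : IsPowSemilinear K m h) (hb : Function.Bijective h) : L ≃+ L :=
  AddEquiv.ofBijective (AddMonoidHom.mk' h hh.map_add) hb

end IsPowSemilinear

/-! ### Semilinear polynomials and their weak equivalences -/

section Classification

variable {Fq Ft Fn : Type*} [Field Fq] [Field Ft] [Field Fn] [Algebra Fq Ft] [Algebra Ft Fn]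
  [Finite Ft]

theorem pow_card_pow_mul_add (k s : ℕ) (c : Ft) :
    c ^ (Nat.card Fq ^ (k * Module.finrank Fq Ft + s)) = c ^ (Nat.card Fq ^ s) :=
  (forall_pow_card_pow_eq_iff Fq Ft _ _).2 (by simp [Nat.ModEq]) c

variable (Fq Ft) in
/-- Polynomials `∑ a_i x^{q^{it+s}}` are semilinear with respect to `c ↦ c ^ (q ^ s)`. -/
theorem isPowSemilinear_eval [Finite Fn] [Algebra Fq Fn] {s t' : ℕ} (a : Fin t' → Fn) :
    IsPowSemilinear Ft (Nat.card Fq ^ s) fun x => (∑ i : Fin t',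
      C (a i) * X ^ (Nat.card Fq ^ ((i : ℕ) * Module.finrank Fq Ft + s)) : Fn[X]).eval x where
  map_add x y := by
    simp [eval_finsetSum, add_pow_card_pow Fq, mul_add, Finset.sum_add_distrib]
  map_smul c x := by
    simp only [eval_finsetSum, eval_mul, eval_C, eval_pow, eval_X, _root_.smul_pow,
      pow_card_pow_mul_add, mul_smul_comm, Finset.smul_sum]

/-- A semilinear map with companion automorphism generating the Galois group is partially
scattered iff it is injective. -/
theorem isRPartiallyScattered_iff_injective [Algebra Fq Fn] [IsScalarTower Fq Ft Fn]
    {s : ℕ} (hs : s.Coprime (Module.finrank Fq Ft)) (ht : Module.finrank Fq Ft ≠ 1) {f : Fn[X]}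
    (hf : IsPowSemilinear Ft (Nat.card Fq ^ s) fun x => f.eval x) :
    IsRPartiallyScattered Fq Ft f ↔ Function.Injective fun x => f.eval x := by
  rw [hf.injective_iff]
  constructor
  · intro h x hx
    -- If `f` kills `x ≠ 0`, it kills all of `Ft • x`; the common quotient `0` then forces `Ft =
    -- Fq`.
    by_contra hx0
    apply ht
    rw [← Subalgebra.bot_eq_top_iff_finrank_eq_one, eq_top_iff]
    rintro c -
    rw [Algebra.mem_bot]
    rcases eq_or_ne c 0 with rfl | hc
    · exact ⟨0, map_zero _⟩
    have hcx : c • x ≠ 0 := smul_ne_zero hc hx0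
    have hd : c • x / x = algebraMap Ft Fn c := by
      rw [Algebra.smul_def, mul_div_cancel_right₀ _ hx0]
    obtain ⟨b, hb⟩ := h (c • x) x hcx hx0
      (by rw [show f.eval (c • x) = _ from hf.map_smul c x, show f.eval x = 0 from hx]; simp)
      ⟨c, hd.symm⟩
    refine ⟨b, (algebraMap Ft Fn).injective ?_⟩
    rw [← hd, ← hb, ← IsScalarTower.algebraMap_apply]
  · rintro h y z hy hz hyz ⟨c, hc⟩
    have hcz : y = c • z := by rw [Algebra.smul_def, hc, div_mul_cancel₀ _ hz]
    subst hcz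
    have hfz : f.eval z ≠ 0 := fun h0 => hz (h z h0)
    have hpow : c ^ (Nat.card Fq ^ s) = c := by
      rw [show f.eval (c • z) = _ from hf.map_smul c z, div_eq_div_iff hy hz,
        Algebra.smul_def, Algebra.smul_def] at hyz
      apply (algebraMap Ft Fn).injective
      have hne : f.eval z * z ≠ 0 := mul_ne_zero hfz hz
      apply mul_right_cancel₀ hne
      linear_combination hyz
    obtain ⟨b, rfl⟩ := mem_range_algebraMap_of_pow_card_pow_eq hs hpow
    exact ⟨b, by rw [← hc, ← IsScalarTower.algebraMap_apply]⟩

/-- The map `(x, y) ↦ (x, g (f⁻¹ y))` works: the companions of `f` and `g` coincide, so `g ∘ f⁻¹` is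
`Ft`-linear. -/
theorem weaklyEquivalent_of_modEq [Finite Fn] {s s' : ℕ} {f g : Fn[X]}
    (hf : IsPowSemilinear Ft (Nat.card Fq ^ s) fun x => f.eval x)
    (hg : IsPowSemilinear Ft (Nat.card Fq ^ s') fun x => g.eval x)
    (hfi : Function.Injective fun x => f.eval x) (hgi : Function.Injective fun x => g.eval x)
    (h : s ≡ s' [MOD Module.finrank Fq Ft]) : WeaklyEquivalent Ft f g := by
  have hfb := Finite.injective_iff_bijective.1 hfi
  have hgb := Finite.injective_iff_bijective.1 hgi
  refine ⟨RingEquiv.refl Ft, AddEquiv.prodCongr (AddEquiv.refl Fn)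
    ((hf.addEquiv hfb).symm.trans (hg.addEquiv hgb)), ?_, ?_⟩
  · rintro c ⟨x, y⟩
    obtain ⟨y, rfl⟩ := (hf.addEquiv hfb).surjective y
    obtain ⟨d, rfl⟩ : ∃ d : Ft, d ^ Nat.card Fq ^ s = c := by
      refine (Finite.injective_iff_surjective (f := fun d : Ft => d ^ Nat.card Fq ^ s)).1 ?_ c
      have := finite_of_algebra_finite Fq Ft
      have := Fintype.ofFinite Fq
      simp only [← frobenius_pow_apply]
      exact AlgEquiv.injective _
    have h2 := (forall_pow_card_pow_eq_iff Fq Ft _ _).2 h d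
    have h3 : d ^ Nat.card Fq ^ s • hf.addEquiv hfb y = hf.addEquiv hfb (d • y) :=
      (hf.map_smul d y).symm
    have h4 := hg.map_smul d y
    rw [← h2] at h4
    refine Prod.ext rfl ?_
    change hg.addEquiv hgb ((hf.addEquiv hfb).symm (d ^ Nat.card Fq ^ s • hf.addEquiv hfb y)) =
      d ^ Nat.card Fq ^ s • hg.addEquiv hgb ((hf.addEquiv hfb).symm (hf.addEquiv hfb y))
    rw [h3, AddEquiv.symm_apply_apply, AddEquiv.symm_apply_apply]
    exact h4
  · rw [graphSet, graphSet, ← Set.range_comp]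
    congr 1
    ext x : 1
    refine Prod.ext rfl ?_
    change hg.addEquiv hgb ((hf.addEquiv hfb).symm (hf.addEquiv hfb x)) = g.eval x
    rw [AddEquiv.symm_apply_apply]
    rfl

/-- The map `(x, y) ↦ (y, g (f x))` works: the companions are mutually inverse, so `g ∘ f` is
`Ft`-linear. -/
theorem weaklyEquivalent_of_add_modEq_zero [Finite Fn] {s s' : ℕ} {f g : Fn[X]}
    (hf : IsPowSemilinear Ft (Nat.card Fq ^ s) fun x => f.eval x)
    (hg : IsPowSemilinear Ft (Nat.card Fq ^ s') fun x => g.eval x)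
    (hfi : Function.Injective fun x => f.eval x) (hgi : Function.Injective fun x => g.eval x)
    (h : s + s' ≡ 0 [MOD Module.finrank Fq Ft]) : WeaklyEquivalent Ft f g := by
  have hfb := Finite.injective_iff_bijective.1 hfi
  have hgb := Finite.injective_iff_bijective.1 hgi
  refine ⟨RingEquiv.refl Ft, AddEquiv.prodComm.trans (AddEquiv.prodCongr (AddEquiv.refl Fn)
    ((hf.addEquiv hfb).trans (hg.addEquiv hgb))), ?_, ?_⟩
  · rintro c ⟨x, y⟩
    have h1 := (forall_pow_card_pow_eq_iff Fq Ft _ _).2 h c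
    rw [pow_zero, pow_one, pow_add, pow_mul] at h1
    have h2 := hf.map_smul c x
    have h3 := hg.map_smul (c ^ Nat.card Fq ^ s) (f.eval x)
    rw [h1] at h3
    refine Prod.ext rfl ?_
    change g.eval (f.eval (c • x)) = c • g.eval (f.eval x)
    rw [h2]
    exact h3
  · rw [graphSet, graphSet, ← Set.range_comp, ← hfb.surjective.range_comp fun x => (x, g.eval x)]
    rfl

/-- Weak equivalence of bijective semilinear maps forces the companion automorphisms to be equal or
inverse to each other. -/
theorem modEq_or_of_weaklyEquivalent {s s' : ℕ} {f g : Fn[X]}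
    (hf : IsPowSemilinear Ft (Nat.card Fq ^ s) fun x => f.eval x)
    (hg : IsPowSemilinear Ft (Nat.card Fq ^ s') fun x => g.eval x)
    (hgi : Function.Injective fun x => g.eval x)
    (hs : ¬ s ≡ 0 [MOD Module.finrank Fq Ft]) (hs' : ¬ s' ≡ 0 [MOD Module.finrank Fq Ft])
    (h : WeaklyEquivalent Ft f g) :
    s ≡ s' [MOD Module.finrank Fq Ft] ∨ s + s' ≡ 0 [MOD Module.finrank Fq Ft] := by
  by_contra! hne
  obtain ⟨ρ, φ, hφ, hfg⟩ := h
  have hρ (d : Ft) (m : ℕ) : ρ (ρ.symm d ^ m) = d ^ m := by simp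
  have hkey (x : Fn) : g.eval ((φ (x, 0)).1 + (φ (0, f.eval x)).1) =
      (φ (x, 0)).2 + (φ (0, f.eval x)).2 := by
    have hx : φ (x, f.eval x) ∈ graphSet g := by
      rw [← hfg]; exact ⟨_, ⟨x, rfl⟩, rfl⟩
    obtain ⟨y, hy⟩ := hx
    have hsum : φ (x, f.eval x) = φ (x, 0) + φ (0, f.eval x) := by
      rw [← map_add, Prod.mk_add_mk, add_zero, zero_add]
    rw [hsum] at hy
    have hy1 := congrArg Prod.fst hy
    have hy2 := congrArg Prod.snd hy
    simp only [Prod.fst_add, Prod.snd_add] at hy1 hy2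
    rw [← hy1, ← hy2]
  -- Putting `ρ⁻¹(d) • x` for `x` in `hkey` gives a relation among four Frobenius powers of `d`,
  -- pairwise distinct under the assumed negation; hence all coefficients vanish.
  have hzero (x : Fn) := eq_zero_of_sum_pow_card_pow_smul (K := Fq) (L := Ft) (M := Fn)
    (k := ![s', 0, s, s + s'])
    (a := ![g.eval (φ (x, 0)).1, -(φ (x, 0)).2, -(φ (0, f.eval x)).2,
      g.eval (φ (0, f.eval x)).1])
    (by
      have e1 : ∀ a b : ℕ, a ≡ a + b [MOD Module.finrank Fq Ft] ↔
          b ≡ 0 [MOD Module.finrank Fq Ft] := fun a b => by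
        rw [Nat.ModEq.comm, ← Nat.ModEq.add_iff_left (Nat.ModEq.refl a) (c := b) (d := 0), add_zero]
      have e2 : ¬ s' ≡ s + s' [MOD Module.finrank Fq Ft] := by rwa [add_comm, e1]
      have e3 : ¬ s ≡ s + s' [MOD Module.finrank Fq Ft] := by rwa [e1]
      intro i j hij
      fin_cases i <;> fin_cases j <;>
        first
        | rfl
        | exact absurd hij ‹_›
        | exact absurd hij.symm ‹_›
        | exact absurd hij hne.1
        | exact absurd hij.symm hne.1
        | exact absurd hij hne.2
        | exact absurd hij.symm hne.2)
    (by
      intro d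
      have hk := hkey (ρ.symm d • x)
      have h1 : (ρ.symm d • x, (0 : Fn)) = ρ.symm d • (x, (0 : Fn)) := by simp
      have h2 : ((0 : Fn), f.eval (ρ.symm d • x)) =
          ρ.symm d ^ Nat.card Fq ^ s • ((0 : Fn), f.eval x) := by
        rw [show f.eval (ρ.symm d • x) = _ from hf.map_smul _ _]; simp
      have hga : ∀ x y : Fn, g.eval (x + y) = g.eval x + g.eval y := hg.map_add
      have hgs : ∀ (c : Ft) (x : Fn), g.eval (c • x) = c ^ Nat.card Fq ^ s' • g.eval x :=
        hg.map_smul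
      rw [h1, h2, hφ, hφ, hρ, ρ.apply_symm_apply, Prod.smul_fst, Prod.smul_fst, Prod.smul_snd,
        Prod.smul_snd, hga, hgs, hgs, ← pow_mul, ← pow_add] at hk
      simp only [Fin.sum_univ_four, Matrix.cons_val, pow_zero, pow_one, smul_neg]
      linear_combination hk)
  have hg0 := hg.injective_iff.1 hgi
  -- The first two coefficients alone contradict the injectivity of `φ`.
  have h1 (x : Fn) : φ (x, 0) = 0 :=
    Prod.ext (hg0 _ (hzero x 0)) (neg_eq_zero.1 (hzero x 1))
  have := congrArg Prod.fst (φ.map_eq_zero_iff.1 (h1 1))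
  exact one_ne_zero this

end Classification

/-! ### Counting the classes -/

/-- If the fibres of a surjection are the orbits of a fixed-point-free map, the source has twice
as many elements as the target. -/
theorem card_eq_two_mul_card_of_fibers {G Q : Type*} [Finite G] {Φ : G → Q}
    (hΦ : Function.Surjective Φ) (i : G → G) (hi : ∀ u, i u ≠ u)
    (h : ∀ u v, Φ v = Φ u ↔ v = u ∨ v = i u) : Nat.card G = 2 * Nat.card Q := by
  classical
  have := Finite.of_surjective Φ hΦ
  have := Fintype.ofFinite G
  have := Fintype.ofFinite Q
  have hfib (b : Q) : (Finset.univ.filter fun v => Φ v = b).card = 2 := by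
    obtain ⟨u, rfl⟩ := hΦ b
    rw [← Finset.card_pair (hi u).symm]
    congr 1
    ext v
    simp [h]
  rw [Nat.card_eq_fintype_card, Nat.card_eq_fintype_card, ← Finset.card_univ,
    Finset.card_eq_sum_card_fiberwise (f := Φ) (t := Finset.univ) (by simp)]
  simp [hfib, mul_comm]

/-- Cancelling the unit in `2u = 0` would leave `t ∣ 2`. -/
theorem ZMod.units_neg_ne_self {t : ℕ} (ht : 3 ≤ t) (u : (ZMod t)ˣ) : -u ≠ u := by
  intro h
  have h1 : (u : ZMod t) + u = 0 := by
    nth_rw 1 [← h]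
    simp
  have h2 : ((2 : ℕ) : ZMod t) = 0 := by
    have h3 : (u : ZMod t) * 2 = 0 := by rw [mul_two, h1]
    simpa using h3
  rw [ZMod.natCast_eq_zero_iff] at h2
  exact absurd (Nat.le_of_dvd two_pos h2) (by omega)

theorem isOfForm_X_pow {Fn : Type*} [Field Fn] {q t t' s : ℕ} (ht' : 0 < t') (hs : s.Coprime t) :
    IsOfForm q t t' (X ^ q ^ s : Fn[X]) := by
  refine ⟨s, hs, fun i => if i = ⟨0, ht'⟩ then 1 else 0, ?_⟩
  rw [Finset.sum_eq_single ⟨0, ht'⟩] <;> simp +contextual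

theorem injective_eval_X_pow (Fq : Type*) {Fn : Type*} [Field Fq] [Field Fn] [Finite Fn]
    [Algebra Fq Fn] (s : ℕ) :
    Function.Injective fun x => (X ^ Nat.card Fq ^ s : Fn[X]).eval x := by
  have := finite_of_algebra_finite Fq Fn
  have := Fintype.ofFinite Fq
  simp only [eval_pow, eval_X, ← frobenius_pow_apply]
  exact AlgEquiv.injective _

theorem mainTheorem9 (Fq Ft Fn : Type*) [Field Fq] [Field Ft] [Field Fn] [Finite Fn]
    [Algebra Fq Ft] [Algebra Ft Fn] [Algebra Fq Fn] [IsScalarTower Fq Ft Fn]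
    (q t t' : ℕ) (hq : Nat.card Fq = q) (ht : Module.finrank Fq Ft = t)
    (ht' : Module.finrank Ft Fn = t') (ht3 : 3 ≤ t) :
    (Nat.card (Quotient (weakEquivalenceSetoid Fq Ft Fn q t t')) : ℚ) =
      (Nat.totient t : ℚ) / 2 := by
  have : Finite Ft := finite_of_algebra_finite Ft Fn
  have ht'0 : 0 < t' := ht' ▸ Module.finrank_pos
  have ht1 : Module.finrank Fq Ft ≠ 1 := by omega
  have ht0 : NeZero t := ⟨by omega⟩
  have : Fact (1 < t) := ⟨by omega⟩
  subst hq
  have hsemi {f : Fn[X]} {s : ℕ} {a : Fin t' → Fn}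
      (ha : f = ∑ i : Fin t', C (a i) * X ^ (Nat.card Fq ^ ((i : ℕ) * t + s))) :
      IsPowSemilinear Ft (Nat.card Fq ^ s) fun x => f.eval x := by
    subst ha ht
    exact isPowSemilinear_eval Fq Ft a
  have hmono (s : ℕ) :
      IsPowSemilinear Ft (Nat.card Fq ^ s) fun x => (X ^ Nat.card Fq ^ s : Fn[X]).eval x :=
    ⟨by simp [add_pow_card_pow Fq], by simp [_root_.smul_pow]⟩
  have hinj (s : ℕ) := injective_eval_X_pow Fq (Fn := Fn) s
  have hcop (u : (ZMod t)ˣ) : (u : ZMod t).val.Coprime t := ZMod.val_coe_unit_coprime u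
  have hpoly (u : (ZMod t)ˣ) :
      IsOfForm (Nat.card Fq) t t' (X ^ Nat.card Fq ^ (u : ZMod t).val : Fn[X]) ∧
      IsRPartiallyScattered Fq Ft (X ^ Nat.card Fq ^ (u : ZMod t).val : Fn[X]) :=
    ⟨isOfForm_X_pow ht'0 (hcop u),
      (isRPartiallyScattered_iff_injective (ht ▸ hcop u) ht1 (hmono _)).2 (hinj _)⟩
  -- Monomials represent all classes, and the fibres of `Φ` are the pairs `{u, -u}`.
  let Φ : (ZMod t)ˣ → Quotient (weakEquivalenceSetoid Fq Ft Fn (Nat.card Fq) t t') :=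
    fun u => Quotient.mk _ ⟨_, hpoly u⟩
  have hcard := card_eq_two_mul_card_of_fibers (Φ := Φ) ?_ (fun u => -u)
    (ZMod.units_neg_ne_self ht3) ?_
  · rw [Nat.card_eq_fintype_card, ZMod.card_units_eq_totient] at hcard
    rw [hcard]
    push_cast
    ring
  · intro b
    obtain ⟨⟨f, ⟨s, hs, a, ha⟩, hf⟩, rfl⟩ := Quotient.exists_rep b
    refine ⟨ZMod.unitOfCoprime s hs, Quotient.sound ?_⟩
    refine weaklyEquivalent_of_modEq (hmono _) (hsemi ha) (hinj _)
      ((isRPartiallyScattered_iff_injective (ht ▸ hs) ht1 (hsemi ha)).1 hf) ?_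
    rw [ht, ← ZMod.natCast_eq_natCast_iff]
    simp
  · have hne (u : (ZMod t)ˣ) : ¬ (u : ZMod t).val ≡ 0 [MOD Module.finrank Fq Ft] := by
      rw [ht, ← ZMod.natCast_eq_natCast_iff]
      simp
    have hadd (u v : (ZMod t)ˣ) :
        (v : ZMod t).val + (u : ZMod t).val ≡ 0 [MOD Module.finrank Fq Ft] ↔ v = -u := by
      rw [ht, ← ZMod.natCast_eq_natCast_iff, Units.ext_iff]
      simp [add_eq_zero_iff_eq_neg]
    intro u v
    constructor
    · intro h
      refine (modEq_or_of_weaklyEquivalent (hmono _) (hmono _) (hinj _) (hne v) (hne u)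
        (Quotient.exact h)).imp (fun h => ?_) (hadd u v).1
      rw [ht, ← ZMod.natCast_eq_natCast_iff] at h
      simpa [Units.ext_iff] using h
    · rintro (rfl | h)
      · rfl
      · exact Quotient.sound (weaklyEquivalent_of_add_modEq_zero (hmono _) (hmono _) (hinj _)
          (hinj _) ((hadd u v).2 h))
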